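/- For a finite simple graph $G=(V,E)$, let $(X_t)_{t\ge 0}$ be the interchange process on $G$: the continuous-time Markov jump process on the permutations of $V$ which starts at the identity and, for every edge $\{x,y\}\in E$, jumps from $\sigma$ to $\tau_{\{x,y\}}\circ\sigma$ at rate $1$, where $\tau_{\{x,y\}}$ is the transposition of $x$ and $y$. Let $N(\sigma)$ be the number of cycles of $\sigma$ (fixed points included). For $\theta>0$ put $Z_\theta(t)=\mathbb E\big(\theta^{N(X_t)}\big)$ and, for a set $A$ of permutations of $V$, $$\mathbb P_{\theta,t}(A)=\frac{1}{Z_\theta(t)}\,\mathbb E\big(\theta^{N(X_t)}\mathbf 1_{X_t\in A}\big).$$ For $\eta>0$ let $A_\eta$ be the event that the permutation has a cycle of size larger than $\eta|V|$. Let $p_{n,d}$ be the uniform probability measure on the $d$-regular simple graphs with vertex set $\{1,\dots,n\}$. Theorem. Let $\theta\ge 2$ and $d>2(\theta+1)$ be integers, and let $$t>T(\theta,d)=\frac{2\theta\log\theta}{(\theta-1)\,(d-2(1+\theta))}.$$ Then there are $\epsilon,\eta>0$ such that $$p_{n,d}\big(\mathbb P_{\theta,t}(A_\eta)\ge\epsilon\big)\longrightarrow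 1$$ as $n\to\infty$ along the integers $n$ for which $nd$ is even. The case $\theta=2$ is the quantum Heisenberg model. -/

import Mathlib

open Filter Topology MeasureTheory ProbabilityTheory

noncomputable section

namespace Interchange

/-- The transposition `τ_e` attached to an unordered pair `e = {x, y}` (the identity if
`x = y`). -/
def transposition {V : Type*} [DecidableEq V] : Sym2 V → Equiv.Perm V :=
  Sym2.lift ⟨fun x y => Equiv.swap x y, fun x y => Equiv.swap_comm x y⟩

/-- `N(σ)`: the number of cycles of `σ`, fixed points counted as cycles of size one. -/
def numCycles {V : Type*} (σ : Equiv.Perm V) : ℕ :=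
  Nat.card (Quotient (Equiv.Perm.SameCycle.setoid σ))

/-- The generator of the interchange process on the graph `G`: for every edge `e` of `G`, the
process jumps from `σ` to `τ_e * σ` at rate `1`. The entry at `(σ, σ')` with `σ ≠ σ'` is the rate
of the jump from `σ` to `σ'`, and the entries of every row add up to `0`. -/
def generator {V : Type*} [Fintype V] [DecidableEq V] (G : SimpleGraph V) :
    Matrix (Equiv.Perm V) (Equiv.Perm V) ℝ :=
  open Classical in
  Matrix.of fun σ σ' => ∑ e ∈ G.edgeFinset,
    ((if transposition e * σ = σ' then 1 else 0) - (if σ = σ' then 1 else 0))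

/-- The law of the interchange process `X_t` on `G` at time `t`, as a probability mass function on
permutations. The process starts at the identity permutation, and the transition probabilities
of the continuous-time Markov chain with generator `Q` are the entries of `exp (t Q)`. -/
def law {V : Type*} [Fintype V] [DecidableEq V] (G : SimpleGraph V) (t : ℝ)
    (σ : Equiv.Perm V) : ℝ :=
  NormedSpace.exp (t • generator G) 1 σ

/-- The partition function `Z_θ(t) = E(θ ^ N(X_t))`. -/
def partitionFunction {V : Type*} [Fintype V] [DecidableEq V] (G : SimpleGraph V)
    (θ t : ℝ) : ℝ :=
  ∑ σ : Equiv.Perm V, law G t σ * θ ^ numCycles σ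

/-- The weighted measure `P_{θ,t}(A) = E(θ ^ N(X_t) 1_A) / Z_θ(t)` on permutations. -/
def permProb {V : Type*} [Fintype V] [DecidableEq V] (G : SimpleGraph V) (θ t : ℝ)
    (A : Set (Equiv.Perm V)) : ℝ :=
  (∑ σ : Equiv.Perm V, law G t σ * θ ^ numCycles σ * A.indicator 1 σ) / partitionFunction G θ t

/-- The event `A_η`: the permutation has a cycle of size larger than `η |V|`. -/
def hasLargeCycle (V : Type*) (η : ℝ) : Set (Equiv.Perm V) :=
  {σ | ∃ x : V, η * (Nat.card V : ℝ) < (Nat.card {y : V // σ.SameCycle x y} : ℝ)}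

/-- The set of all (simple, labelled) `d`-regular graphs on `n` vertices. -/
def regularGraphs (d n : ℕ) : Set (SimpleGraph (Fin n)) :=
  open Classical in {G | G.IsRegularOfDegree d}

/-- `p_{n,d}`: the uniform probability measure on `d`-regular graphs on `n` vertices. It is a
probability measure when such graphs exist, that is when `d < n` and `n * d` is even (or when
`d = 0`). -/
def randomRegular (d n : ℕ) : Measure (SimpleGraph (Fin n)) :=
  uniformOn (regularGraphs d n)

end Interchange

end

/-! For integer `θ`, `θ ^ N(σ)` is the trace of `σ` acting on the colourings of `V` with `θ`
colours, so `Z(t) = tr exp(tH)` with `H` symmetric (`sum_law_mul_trace`, `trace_colourMatrix`).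
Hence `log Z` is convex, and since `Z(0) = θ ^ |V|` and `Z(t) ≥ 1`, its derivative at `t` is at
least `-|V| log θ / t` (`drift_ge`).

The same derivative is a weighted mean over `σ` of edge contributions. An edge joining two cycles
merges them and contributes `1/θ - 1`; an edge inside a cycle contributes at most `θ - 1`. If all
cycles are small and every small vertex set spans few edges, at most `(1 + 1/q)|V|` of the `d|V|/2`
edges are internal (`card_isInternal_le`), so the derivative is too negative once `t > T(θ, d)`.
Long cycles must therefore carry positive weight (`permProb_hasLargeCycle_ge`).

It remains that a random regular graph is sparse on small sets with high probability. Switchings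
bound the probability of containing a prescribed edge set `F` by `(2d/n) ^ |F|`
(`card_regularContaining_le`), and a union bound finishes (`card_not_isSparse_le`,
`tendsto_sum_unionTerm`). -/

noncomputable section

namespace Interchange

/-! ### Matrix exponentials: positivity, and convexity of the log-trace. -/

section Exponential

open Matrix

variable {m n : Type*} [Fintype m] [DecidableEq m] [Fintype n] [DecidableEq n]

theorem hasSum_matrix_exp (A : Matrix m m ℝ) :
    HasSum (fun k : ℕ => ((k.factorial : ℝ)⁻¹) • A ^ k) (NormedSpace.exp A) := by
  open scoped Matrix.Norms.Operator in
  exact NormedSpace.exp_series_hasSum_exp' (𝕂 := ℝ) A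

theorem hasSum_linearMap_exp (A : Matrix m m ℝ) (L : Matrix m m ℝ →ₗ[ℝ] ℝ) :
    HasSum (fun k : ℕ => ((k.factorial : ℝ)⁻¹) * L (A ^ k)) (L (NormedSpace.exp A)) := by
  have h := (hasSum_matrix_exp A).map L.toAddMonoidHom L.continuous_of_finiteDimensional
  simpa [Function.comp_def] using h

theorem linearMap_exp_eq {A : Matrix m m ℝ} {B : Matrix n n ℝ} {L : Matrix m m ℝ →ₗ[ℝ] ℝ}
    {M : Matrix n n ℝ →ₗ[ℝ] ℝ} (h : ∀ k : ℕ, L (A ^ k) = M (B ^ k)) (t : ℝ) :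
    L (NormedSpace.exp (t • A)) = M (NormedSpace.exp (t • B)) := by
  have h₁ := hasSum_linearMap_exp (t • A) L
  have h₂ := hasSum_linearMap_exp (t • B) M
  simp only [smul_pow, map_smul, h] at h₁ h₂
  exact h₁.unique h₂

theorem exp_apply_nonneg {A : Matrix m m ℝ} (hA : ∀ i j, 0 ≤ A i j) (i j : m) :
    0 ≤ NormedSpace.exp A i j := by
  have hpow : ∀ (k : ℕ) (i j : m), 0 ≤ (A ^ k) i j := by
    intro k
    induction k with
    | zero =>
      intro i j
      rw [pow_zero, Matrix.one_apply]
      split_ifs <;> norm_num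
    | succ k ih =>
      intro i j
      rw [pow_succ, Matrix.mul_apply]
      exact Finset.sum_nonneg fun l _ => mul_nonneg (ih i l) (hA l j)
  exact (hasSum_linearMap_exp A (Matrix.entryLinearMap ℝ ℝ i j)).nonneg fun k =>
    mul_nonneg (by positivity) (hpow k i j)

/-- A multiple of the identity commutes with `A`, so the shift only multiplies the exponential by a
positive scalar. A generator has negative diagonal entries, hence the need for it. -/
theorem exp_apply_nonneg_of_add_diagonal {A : Matrix m m ℝ} (r : ℝ)
    (hA : ∀ i j, 0 ≤ (A + r • (1 : Matrix m m ℝ)) i j) (i j : m) :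
    0 ≤ NormedSpace.exp A i j := by
  have h : NormedSpace.exp A =
      NormedSpace.exp (A + r • (1 : Matrix m m ℝ)) * NormedSpace.exp ((-r) • (1 : Matrix m m ℝ)) := by
    rw [← Matrix.exp_add_of_commute]
    · simp
    · exact (Commute.one_right _).smul_right _
  have hd : NormedSpace.exp ((-r) • (1 : Matrix m m ℝ)) = Real.exp (-r) • (1 : Matrix m m ℝ) := by
    rw [Matrix.smul_one_eq_diagonal, Matrix.exp_diagonal, Matrix.smul_one_eq_diagonal]
    congr 1
    ext i
    rw [Pi.coe_exp, Real.exp_eq_exp_ℝ]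
  rw [h, hd, Matrix.mul_smul, Matrix.mul_one, Matrix.smul_apply, smul_eq_mul]
  exact mul_nonneg (Real.exp_pos _).le (exp_apply_nonneg hA i j)

theorem trace_conj_diagonal (U : Matrix.unitaryGroup m ℝ) (v : m → ℝ) :
    ((U : Matrix m m ℝ) * Matrix.diagonal v * star (U : Matrix m m ℝ)).trace = ∑ i, v i := by
  rw [Matrix.trace_mul_comm, ← Matrix.mul_assoc, Unitary.coe_star_mul_self, Matrix.one_mul,
    Matrix.trace_diagonal]

theorem exp_smul_isHermitian {H : Matrix m m ℝ} (hH : H.IsHermitian) (t : ℝ) :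
    NormedSpace.exp (t • H) = (hH.eigenvectorUnitary : Matrix m m ℝ) *
      Matrix.diagonal (fun i => Real.exp (t * hH.eigenvalues i)) *
        star (hH.eigenvectorUnitary : Matrix m m ℝ) := by
  have hinv : (hH.eigenvectorUnitary : Matrix m m ℝ)⁻¹ =
      star (hH.eigenvectorUnitary : Matrix m m ℝ) :=
    Matrix.inv_eq_left_inv (Unitary.coe_star_mul_self _)
  have hu : IsUnit (hH.eigenvectorUnitary : Matrix m m ℝ) :=
    (Unitary.toUnits hH.eigenvectorUnitary).isUnit
  have h : t • H = (hH.eigenvectorUnitary : Matrix m m ℝ) *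
      Matrix.diagonal (fun i => t * hH.eigenvalues i) *
        (hH.eigenvectorUnitary : Matrix m m ℝ)⁻¹ := by
    conv_lhs => rw [hH.spectral_theorem, Unitary.conjStarAlgAut_apply]
    rw [hinv, ← Matrix.smul_mul, ← Matrix.mul_smul, ← Matrix.diagonal_smul]
    rfl
  rw [h, Matrix.exp_conj _ _ hu, hinv, Matrix.exp_diagonal]
  congr 3
  ext i
  rw [Pi.coe_exp, Real.exp_eq_exp_ℝ]

theorem trace_exp_smul_isHermitian {H : Matrix m m ℝ} (hH : H.IsHermitian) (t : ℝ) :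
    (NormedSpace.exp (t • H)).trace = ∑ i, Real.exp (t * hH.eigenvalues i) := by
  rw [exp_smul_isHermitian hH, trace_conj_diagonal]

theorem trace_mul_exp_smul_isHermitian {H : Matrix m m ℝ} (hH : H.IsHermitian) (t : ℝ) :
    (H * NormedSpace.exp (t • H)).trace =
      ∑ i, hH.eigenvalues i * Real.exp (t * hH.eigenvalues i) := by
  have h : H = (hH.eigenvectorUnitary : Matrix m m ℝ) * Matrix.diagonal hH.eigenvalues *
      star (hH.eigenvectorUnitary : Matrix m m ℝ) := by
    conv_lhs => rw [hH.spectral_theorem, Unitary.conjStarAlgAut_apply]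
    rfl
  have hmul : H * NormedSpace.exp (t • H) = (hH.eigenvectorUnitary : Matrix m m ℝ) *
      Matrix.diagonal (fun i => hH.eigenvalues i * Real.exp (t * hH.eigenvalues i)) *
        star (hH.eigenvectorUnitary : Matrix m m ℝ) := by
    rw [exp_smul_isHermitian hH, ← Matrix.diagonal_mul_diagonal]
    conv_lhs => enter [1]; rw [h]
    simp only [Matrix.mul_assoc]
    rw [← Matrix.mul_assoc (star _) _ (_ * _), Unitary.coe_star_mul_self, Matrix.one_mul]
  rw [hmul, trace_conj_diagonal]

/-- The convexity of `log ∑ exp (t λ_i)`, in the form that its derivative at `t` is at least the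
slope of its chord over `[0, t]`. -/
theorem log_sum_exp_le {ι : Type*} (s : Finset ι) (hs : s.Nonempty) (x : ι → ℝ) :
    (Real.log (∑ i ∈ s, Real.exp (x i)) - Real.log s.card) * ∑ i ∈ s, Real.exp (x i) ≤
      ∑ i ∈ s, x i * Real.exp (x i) := by
  set Z := ∑ i ∈ s, Real.exp (x i) with hZ
  have hZpos : 0 < Z := Finset.sum_pos (fun i _ => Real.exp_pos _) hs
  have hc : (0 : ℝ) < s.card := by exact_mod_cast hs.card_pos
  -- `exp y` is the mean of the `exp (x i)`, so the left sides of the tangent-line bounds `hterm`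
  -- add up to zero.
  set y := Real.log Z - Real.log s.card with hy
  have hey : Real.exp y = Z / s.card := by
    rw [hy, Real.exp_sub, Real.exp_log hZpos, Real.exp_log hc]
  have hterm : ∀ i ∈ s, Real.exp (x i) - Real.exp y ≤ (x i - y) * Real.exp (x i) := by
    intro i _
    have h := Real.add_one_le_exp (y - x i)
    have h2 : Real.exp y = Real.exp (x i) * Real.exp (y - x i) := by
      rw [← Real.exp_add]; congr 1; ring
    rw [h2]
    nlinarith [Real.exp_pos (x i)]
  have hsum := Finset.sum_le_sum hterm
  simp only [Finset.sum_sub_distrib, sub_mul, ← Finset.mul_sum, Finset.sum_const, nsmul_eq_mul,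
    hey, ← hZ] at hsum
  have : (s.card : ℝ) * (Z / s.card) = Z := by field_simp
  linarith

theorem trace_mul_exp_ge {H : Matrix m m ℝ} [Nonempty m] (hH : H.IsHermitian) (t : ℝ) :
    (Real.log (NormedSpace.exp (t • H)).trace - Real.log (Fintype.card m)) *
      (NormedSpace.exp (t • H)).trace ≤ t * (H * NormedSpace.exp (t • H)).trace := by
  rw [trace_exp_smul_isHermitian hH, trace_mul_exp_smul_isHermitian hH]
  have h := log_sum_exp_le Finset.univ Finset.univ_nonempty fun i => t * hH.eigenvalues i
  simpa only [Finset.card_univ, mul_assoc, ← Finset.mul_sum] using h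

end Exponential

/-! ### The interchange process: positivity, total mass, and traces of representations. -/

section Chain

open Matrix

variable {V : Type*} [Fintype V] [DecidableEq V]

theorem generator_mulVec (G : SimpleGraph V) [Fintype G.edgeSet] (f : Equiv.Perm V → ℝ)
    (σ : Equiv.Perm V) :
    (generator G *ᵥ f) σ = ∑ e ∈ G.edgeFinset, (f (transposition e * σ) - f σ) := by
  classical
  simp only [Matrix.mulVec, dotProduct, generator, Matrix.of_apply, Finset.sum_mul]
  rw [Finset.sum_comm]
  refine Finset.sum_congr (by ext; simp) fun e _ => ?_
  simp [sub_mul, Finset.sum_sub_distrib]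

theorem law_nonneg (G : SimpleGraph V) {t : ℝ} (ht : 0 ≤ t) (σ : Equiv.Perm V) :
    0 ≤ law G t σ := by
  classical
  refine exp_apply_nonneg_of_add_diagonal (t * G.edgeFinset.card) (fun σ σ' => ?_) 1 σ
  have h : (t • generator G + (t * G.edgeFinset.card) • (1 : Matrix (Equiv.Perm V) (Equiv.Perm V) ℝ))
      σ σ' =
      t * ∑ e ∈ G.edgeFinset, (if transposition e * σ = σ' then (1 : ℝ) else 0) := by
    simp only [Matrix.add_apply, Matrix.smul_apply, generator, Matrix.of_apply, smul_eq_mul,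
      Matrix.one_apply, Finset.sum_sub_distrib, Finset.sum_const, nsmul_eq_mul]
    ring
  rw [h]
  exact mul_nonneg ht (Finset.sum_nonneg fun e _ => by split_ifs <;> norm_num)

/-- The expectation of `f(X_t)`, for a function `f` on permutations, as a linear functional of the
transition matrix. -/
def rowPairing (f : Equiv.Perm V → ℝ) :
    Matrix (Equiv.Perm V) (Equiv.Perm V) ℝ →ₗ[ℝ] ℝ :=
  (LinearMap.proj 1).comp ((Matrix.mulVecBilin ℝ ℝ).flip f)

theorem rowPairing_apply (f : Equiv.Perm V → ℝ) (A : Matrix (Equiv.Perm V) (Equiv.Perm V) ℝ) :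
    rowPairing f A = (A *ᵥ f) 1 := rfl

theorem sum_law_mul (G : SimpleGraph V) (t : ℝ) (f : Equiv.Perm V → ℝ) :
    ∑ σ, law G t σ * f σ = rowPairing f (NormedSpace.exp (t • generator G)) := rfl

theorem generator_mulVec_trace {n : Type*} [Fintype n] [DecidableEq n] (G : SimpleGraph V)
    [Fintype G.edgeSet] {U : Equiv.Perm V → Matrix n n ℝ} (hU : ∀ σ τ, U (σ * τ) = U σ * U τ)
    (B : Matrix n n ℝ) :
    generator G *ᵥ (fun σ => (U σ * B).trace) =
      fun σ => (U σ * (B * ∑ e ∈ G.edgeFinset, (U (transposition e) - 1))).trace := by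
  ext σ
  rw [generator_mulVec, ← Matrix.mul_assoc, Matrix.trace_mul_comm (U σ * B), Finset.sum_mul,
    Matrix.trace_sum]
  refine Finset.sum_congr rfl fun e _ => ?_
  rw [hU, sub_mul, Matrix.one_mul, Matrix.trace_sub, Matrix.mul_assoc]

/-- Cyclicity of the trace turns the generator acting on `σ ↦ tr (U σ * B)` into right
multiplication of `B` by `H`. The two exponential series then agree term by term. -/
theorem sum_law_mul_trace {n : Type*} [Fintype n] [DecidableEq n] (G : SimpleGraph V)
    [Fintype G.edgeSet] {U : Equiv.Perm V → Matrix n n ℝ} (hU : ∀ σ τ, U (σ * τ) = U σ * U τ)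
    (hU1 : U 1 = 1) (B : Matrix n n ℝ) (t : ℝ) :
    ∑ σ, law G t σ * (U σ * B).trace =
      (B * NormedSpace.exp (t • ∑ e ∈ G.edgeFinset, (U (transposition e) - 1))).trace := by
  set H := ∑ e ∈ G.edgeFinset, (U (transposition e) - 1) with hH
  have hpow : ∀ (k : ℕ) (B : Matrix n n ℝ), (generator G ^ k) *ᵥ (fun σ => (U σ * B).trace) =
      fun σ => (U σ * (B * H ^ k)).trace := by
    intro k
    induction k with
    | zero => intro B; simp
    | succ k ih =>
      intro B
      rw [pow_succ, ← Matrix.mulVec_mulVec, generator_mulVec_trace G hU, ih, pow_succ', ← hH]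
      simp only [Matrix.mul_assoc]
  rw [sum_law_mul]
  refine linearMap_exp_eq (M := (Matrix.traceLinearMap n ℝ ℝ).comp (LinearMap.mulLeft ℝ B))
    (fun k => ?_) t
  rw [rowPairing_apply, hpow]
  simp [hU1]

theorem sum_law (G : SimpleGraph V) (t : ℝ) : ∑ σ, law G t σ = 1 := by
  classical
  -- In the trivial representation `H = 0`.
  have h := sum_law_mul_trace G (U := fun _ : Equiv.Perm V => (1 : Matrix Unit Unit ℝ))
    (by simp) rfl 1 t
  simpa using h

end Chain

/-! ### Effect of a transposition on the number of cycles. -/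

section Cycles

variable {V : Type*}

/-- The cycle of `σ` that contains `x`, as an element of the set of cycles. -/
def cycleClass (σ : Equiv.Perm V) (x : V) : Quotient (Equiv.Perm.SameCycle.setoid σ) :=
  Quotient.mk _ x

theorem cycleClass_eq_iff {σ : Equiv.Perm V} {x y : V} :
    cycleClass σ x = cycleClass σ y ↔ σ.SameCycle x y := Quotient.eq

theorem cycleClass_surjective (σ : Equiv.Perm V) : Function.Surjective (cycleClass σ) :=
  Quotient.mk_surjective

theorem cycleClass_apply (σ : Equiv.Perm V) (x : V) : cycleClass σ (σ x) = cycleClass σ x :=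
  cycleClass_eq_iff.2 (Equiv.Perm.SameCycle.refl σ x).apply_left

theorem eq_of_sameCycle_of_invariant {α : Type*} {σ : Equiv.Perm V} {f : V → α}
    (hf : ∀ z, f (σ z) = f z) {x y : V} (h : σ.SameCycle x y) : f x = f y := by
  obtain ⟨k, rfl⟩ := h
  have hinv : ∀ z, f (σ⁻¹ z) = f z := fun z => by
    rw [← hf (σ⁻¹ z), ← Equiv.Perm.mul_apply, mul_inv_cancel, Equiv.Perm.one_apply]
  induction k with
  | zero => simp
  | succ k ih => rw [add_comm, zpow_add, zpow_one, Equiv.Perm.mul_apply, hf, ← ih]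
  | pred k ih => rw [sub_eq_neg_add, zpow_add, zpow_neg_one, Equiv.Perm.mul_apply, hinv, ← ih]

theorem numCycles_eq_card_invariant [Finite V] (σ : Equiv.Perm V) (k : ℕ) :
    k ^ numCycles σ = Nat.card {f : V → Fin k // ∀ z, f (σ z) = f z} := by
  have e : {f : V → Fin k // ∀ z, f (σ z) = f z} ≃
      (Quotient (Equiv.Perm.SameCycle.setoid σ) → Fin k) :=
    { toFun := fun f => Quotient.lift f.1 fun _ _ h => eq_of_sameCycle_of_invariant f.2 h
      invFun := fun g => ⟨fun z => g (cycleClass σ z), fun z => by simp only [cycleClass_apply]⟩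
      left_inv := fun f => rfl
      right_inv := fun g => by
        ext q
        obtain ⟨z, rfl⟩ := cycleClass_surjective σ q
        rfl }
  rw [Nat.card_congr e, Nat.card_fun, Nat.card_eq_fintype_card, Fintype.card_fin, numCycles]

variable [DecidableEq V]

theorem sameCycle_swap_mul [Finite V] {σ : Equiv.Perm V} {x y : V} (h : ¬ σ.SameCycle x y) :
    (Equiv.swap x y * σ).SameCycle x y := by
  classical
  have hex : ∃ k, 0 < k ∧ (σ ^ k) x = x :=
    ⟨orderOf σ, orderOf_pos σ, by rw [pow_orderOf_eq_one, Equiv.Perm.one_apply]⟩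
  -- `k` is the first return time of `x`. Before it the `σ`-orbit of `x` meets neither `x` nor `y`,
  -- so the swap is inactive; at time `k` it redirects `x` to `y`.
  set k := Nat.find hex with hk
  obtain ⟨hk0, hkx⟩ := Nat.find_spec hex
  have hpow : ∀ j < k, ((Equiv.swap x y * σ) ^ j) x = (σ ^ j) x := by
    intro j
    induction j with
    | zero => simp
    | succ j ih =>
      intro hj
      rw [pow_succ', Equiv.Perm.mul_apply, ih (by omega), Equiv.Perm.mul_apply,
        ← Equiv.Perm.mul_apply σ, ← pow_succ']
      refine Equiv.swap_apply_of_ne_of_ne (fun hx => ?_) (fun hy => ?_)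
      · exact Nat.find_min hex hj ⟨j.succ_pos, hx⟩
      · exact h ⟨(j + 1 : ℕ), by rw [zpow_natCast, hy]⟩
  refine ⟨(k : ℕ), ?_⟩
  obtain ⟨j, hj⟩ : ∃ j, k = j + 1 := ⟨k - 1, by omega⟩
  rw [zpow_natCast, hj, pow_succ', Equiv.Perm.mul_apply, hpow j (by omega), Equiv.Perm.mul_apply,
    ← Equiv.Perm.mul_apply σ, ← pow_succ', ← hj, hkx, Equiv.swap_apply_left]

theorem cycleClass_swap_mul_apply [Finite V] {σ : Equiv.Perm V} {x y : V}
    (h : ¬ σ.SameCycle x y) (z : V) :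
    cycleClass (Equiv.swap x y * σ) (σ z) = cycleClass (Equiv.swap x y * σ) z := by
  have hxy := cycleClass_eq_iff.2 (sameCycle_swap_mul h)
  rw [← cycleClass_apply _ z, Equiv.Perm.mul_apply]
  by_cases hx : σ z = x
  · rw [hx, Equiv.swap_apply_left, hxy]
  by_cases hy : σ z = y
  · rw [hy, Equiv.swap_apply_right, hxy]
  rw [Equiv.swap_apply_of_ne_of_ne hx hy]

/-- Each cycle of `σ` lies in one cycle of the product, and those of `x` and `y` lie in the same
one: the induced surjection of cycles is not injective. -/
theorem numCycles_swap_mul_lt [Finite V] {σ : Equiv.Perm V} {x y : V}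
    (h : ¬ σ.SameCycle x y) : numCycles (Equiv.swap x y * σ) < numCycles σ := by
  classical
  have := Fintype.ofFinite V
  let f : Quotient (Equiv.Perm.SameCycle.setoid σ) →
      Quotient (Equiv.Perm.SameCycle.setoid (Equiv.swap x y * σ)) :=
    Quotient.lift (cycleClass (Equiv.swap x y * σ)) fun _ _ hab =>
      eq_of_sameCycle_of_invariant (cycleClass_swap_mul_apply h) hab
  have hf : Function.Surjective f := fun q => by
    obtain ⟨z, rfl⟩ := cycleClass_surjective _ q
    exact ⟨cycleClass σ z, rfl⟩
  rw [numCycles, numCycles, Nat.card_eq_fintype_card, Nat.card_eq_fintype_card]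
  refine lt_of_le_of_ne (Fintype.card_le_of_surjective f hf) fun hcard => ?_
  have hinj := ((Fintype.bijective_iff_surjective_and_card f).2 ⟨hf, hcard.symm⟩).1
  exact h (cycleClass_eq_iff.1 (hinj (cycleClass_eq_iff.2 (sameCycle_swap_mul h) :
    f (cycleClass σ x) = f (cycleClass σ y))))

theorem numCycles_swap_mul_le [Finite V] (σ : Equiv.Perm V) (x y : V) :
    numCycles (Equiv.swap x y * σ) ≤ numCycles σ + 1 := by
  classical
  have := Fintype.ofFinite V
  set p := Equiv.swap x y * σ with hp
  -- Gluing the `p`-cycle of `y` to that of `x` gives a `σ`-invariant map. It misses at most the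
  -- class of `y`, which `none` supplies below.
  let g : V → Quotient (Equiv.Perm.SameCycle.setoid p) := fun z =>
    if cycleClass p z = cycleClass p y then cycleClass p x else cycleClass p z
  have hgx : g x = cycleClass p x := by simp only [g]; split_ifs <;> rfl
  have hgy : g y = cycleClass p x := by simp [g]
  have hgp : ∀ z, g (p z) = g z := fun z => by simp only [g, cycleClass_apply]
  have hgs : ∀ z, g (σ z) = g z := fun z => by
    rw [← hgp z]
    change g (σ z) = g (Equiv.swap x y (σ z))
    by_cases hx : σ z = x
    · rw [hx, Equiv.swap_apply_left, hgx, hgy]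
    by_cases hy : σ z = y
    · rw [hy, Equiv.swap_apply_right, hgx, hgy]
    rw [Equiv.swap_apply_of_ne_of_ne hx hy]
  let f : Option (Quotient (Equiv.Perm.SameCycle.setoid σ)) →
      Quotient (Equiv.Perm.SameCycle.setoid p) := fun o =>
    o.elim (cycleClass p y) (Quotient.lift g fun _ _ hab => eq_of_sameCycle_of_invariant hgs hab)
  have hf : Function.Surjective f := fun q => by
    obtain ⟨z, rfl⟩ := cycleClass_surjective _ q
    by_cases hz : cycleClass p z = cycleClass p y
    · exact ⟨none, hz.symm⟩
    · exact ⟨some (cycleClass σ z), if_neg hz⟩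
  have h := Fintype.card_le_of_surjective f hf
  rwa [Fintype.card_option, ← Nat.card_eq_fintype_card, ← Nat.card_eq_fintype_card] at h

end Cycles

/-! ### The colour representation and the two bounds on the drift. -/

section Colourings

open Matrix

variable {V : Type*} [Fintype V] [DecidableEq V]

/-- The action of a permutation on the colourings of `V` by `k` colours, as a permutation matrix. -/
def colourMatrix (k : ℕ) (σ : Equiv.Perm V) : Matrix (V → Fin k) (V → Fin k) ℝ :=
  Equiv.Perm.permMatrix ℝ (Equiv.arrowCongr σ.symm (Equiv.refl (Fin k)))

/-- Precomposition of colourings and `permMatrix` both reverse products, so together they preserve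
them. -/
theorem colourMatrix_mul (k : ℕ) (σ τ : Equiv.Perm V) :
    colourMatrix k (σ * τ) = colourMatrix k σ * colourMatrix k τ := by
  rw [colourMatrix, colourMatrix, colourMatrix, ← Matrix.permMatrix_mul]
  rfl

omit [DecidableEq V] in
theorem colourMatrix_one (k : ℕ) : colourMatrix k (1 : Equiv.Perm V) = 1 :=
  Matrix.permMatrix_one

omit [DecidableEq V] in
theorem colourMatrix_isHermitian (k : ℕ) {σ : Equiv.Perm V} (hσ : σ⁻¹ = σ) :
    (colourMatrix k σ).IsHermitian := by
  rw [Matrix.IsHermitian, colourMatrix, Matrix.conjTranspose_permMatrix]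
  conv_rhs => rw [← hσ]
  rfl

theorem trace_colourMatrix (k : ℕ) (σ : Equiv.Perm V) :
    (colourMatrix k σ).trace = (k : ℝ) ^ numCycles σ := by
  rw [colourMatrix, Matrix.trace_permutation, ← Nat.cast_pow, numCycles_eq_card_invariant,
    ← Nat.card_coe_set_eq]
  congr 1
  refine Nat.card_congr (Equiv.subtypeEquivRight fun f => ?_)
  exact funext_iff

omit [Fintype V] in
theorem transposition_inv (e : Sym2 V) : (transposition e)⁻¹ = transposition e := by
  induction e with
  | h x y => exact Equiv.swap_inv x y

theorem generator_colour_isHermitian (k : ℕ) (s : Finset (Sym2 V)) :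
    (∑ e ∈ s, (colourMatrix k (transposition e) - 1)).IsHermitian := by
  rw [Matrix.IsHermitian, Matrix.conjTranspose_sum]
  refine Finset.sum_congr rfl fun e _ => ?_
  exact (colourMatrix_isHermitian k (transposition_inv e)).sub Matrix.isHermitian_one

theorem partitionFunction_ge_one (G : SimpleGraph V) {k : ℕ} (hk : 1 ≤ k) {t : ℝ} (ht : 0 ≤ t) :
    1 ≤ partitionFunction G k t := by
  rw [← sum_law G t]
  refine Finset.sum_le_sum fun σ _ => ?_
  exact le_mul_of_one_le_right (law_nonneg G ht σ) (one_le_pow₀ (by exact_mod_cast hk))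

/-- The expected drift of `θ ^ N(X_t)` is at least `-(|V| log θ / t) Z_θ(t)`. -/
theorem drift_ge (G : SimpleGraph V) [Fintype G.edgeSet] {k : ℕ} (hk : 1 ≤ k) {t : ℝ}
    (ht : 0 ≤ t) :
    -(Fintype.card V * Real.log k) * partitionFunction G k t ≤
      t * ∑ σ, law G t σ * ∑ e ∈ G.edgeFinset,
        ((k : ℝ) ^ numCycles (transposition e * σ) - (k : ℝ) ^ numCycles σ) := by
  have := Fin.pos_iff_nonempty.1 hk
  set H := ∑ e ∈ G.edgeFinset, (colourMatrix k (transposition e) - 1) with hH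
  have hZ : partitionFunction G k t = (NormedSpace.exp (t • H)).trace := by
    have h := sum_law_mul_trace G (colourMatrix_mul k) (colourMatrix_one k) 1 t
    simp only [Matrix.mul_one, Matrix.one_mul, trace_colourMatrix] at h
    exact h
  have hW : ∑ σ, law G t σ * ∑ e ∈ G.edgeFinset,
      ((k : ℝ) ^ numCycles (transposition e * σ) - (k : ℝ) ^ numCycles σ) =
        (H * NormedSpace.exp (t • H)).trace := by
    rw [← sum_law_mul_trace G (colourMatrix_mul k) (colourMatrix_one k) H t]
    refine Finset.sum_congr rfl fun σ _ => ?_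
    rw [hH, Matrix.mul_sum, Matrix.trace_sum]
    congr 1
    refine Finset.sum_congr rfl fun e _ => ?_
    rw [Matrix.mul_sub, Matrix.mul_one, Matrix.trace_sub, Matrix.trace_mul_comm,
      ← colourMatrix_mul, trace_colourMatrix, trace_colourMatrix]
  have h1 := partitionFunction_ge_one G hk ht
  rw [hW]
  refine le_trans ?_ (trace_mul_exp_ge (generator_colour_isHermitian k G.edgeFinset) t)
  -- The dimension `k ^ |V|` is `Z(0)`; the term `log Z(t) ≥ 0` is dropped.
  rw [← hZ, Fintype.card_fun, Fintype.card_fin, Nat.cast_pow, Real.log_pow]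
  refine mul_le_mul_of_nonneg_right ?_ (by linarith)
  linarith [Real.log_nonneg h1]

/-- The edge `e` has both ends in one cycle of `σ`. -/
def IsInternal (σ : Equiv.Perm V) (e : Sym2 V) : Prop :=
  (e.map (cycleClass σ)).IsDiag

omit [Fintype V] [DecidableEq V] in
theorem isInternal_mk {σ : Equiv.Perm V} {x y : V} : IsInternal σ s(x, y) ↔ σ.SameCycle x y := by
  rw [IsInternal, Sym2.map_mk, Sym2.mk_isDiag_iff]
  exact cycleClass_eq_iff

open Classical in
-- The last factor encodes both cases: it is `θ - 1` for an internal edge (at most one extra cycle)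
-- and `1/θ - 1` otherwise (at least one cycle lost).
theorem pow_numCycles_transposition_le {θ : ℝ} (hθ : 1 ≤ θ) (σ : Equiv.Perm V) (e : Sym2 V) :
    θ ^ numCycles (transposition e * σ) - θ ^ numCycles σ ≤
      θ ^ numCycles σ * ((1 - 1 / θ) * ((θ + 1) * (if IsInternal σ e then 1 else 0) - 1)) := by
  have hpos : 0 < θ := by linarith
  induction e with
  | h x y =>
    change θ ^ numCycles (Equiv.swap x y * σ) - _ ≤ _
    rw [isInternal_mk]
    split_ifs with h
    · have h1 : θ ^ numCycles (Equiv.swap x y * σ) ≤ θ ^ numCycles σ * θ := by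
        rw [← pow_succ]
        exact pow_le_pow_right₀ hθ (numCycles_swap_mul_le σ x y)
      have h2 : (1 - 1 / θ) * ((θ + 1) * 1 - 1) = θ - 1 := by field_simp; ring
      rw [h2]
      linarith
    · have h1 : θ ^ numCycles (Equiv.swap x y * σ) * θ ≤ θ ^ numCycles σ := by
        rw [← pow_succ]
        exact pow_le_pow_right₀ hθ (numCycles_swap_mul_lt h)
      rw [← le_div_iff₀ hpos] at h1
      have h2 : θ ^ numCycles σ * ((1 - 1 / θ) * ((θ + 1) * 0 - 1)) =
        θ ^ numCycles σ / θ - θ ^ numCycles σ := by field_simp; ring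
      rw [h2]
      linarith

open Classical in
theorem sum_pow_numCycles_transposition_le {θ : ℝ} (hθ : 1 ≤ θ) (σ : Equiv.Perm V)
    (s : Finset (Sym2 V)) :
    ∑ e ∈ s, (θ ^ numCycles (transposition e * σ) - θ ^ numCycles σ) ≤
      θ ^ numCycles σ * ((1 - 1 / θ) * ((θ + 1) * (s.filter (IsInternal σ)).card - s.card)) := by
  refine (Finset.sum_le_sum fun e _ => pow_numCycles_transposition_le hθ σ e).trans_eq ?_
  rw [← Finset.mul_sum, ← Finset.mul_sum, Finset.sum_sub_distrib, ← Finset.mul_sum,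
    Finset.sum_boole]
  simp

end Colourings

/-! ### Switchings in regular graphs. -/

section Switching

variable {V : Type*}

open scoped symmDiff

/-- The four-cycle `x - y - v - u - x`, as a graph. -/
def fourCycle (x y u v : V) : SimpleGraph V :=
  SimpleGraph.fromEdgeSet {s(x, y), s(u, v), s(x, u), s(y, v)}

theorem neighborSet_symmDiff_fourCycle {G : SimpleGraph V} {x y u v : V} (hxu : x ≠ u)
    (hyv : y ≠ v) (hxv : x ≠ v) (hyu : y ≠ u) (h₁ : G.Adj x y) (h₂ : G.Adj u v)
    (h₃ : ¬ G.Adj x u) (h₄ : ¬ G.Adj y v) (a : V) :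
    ((G ∆ fourCycle x y u v).neighborSet a = G.neighborSet a) ∨
      ∃ p ∉ G.neighborSet a, ∃ q ∈ G.neighborSet a,
        (G ∆ fourCycle x y u v).neighborSet a = insert p (G.neighborSet a \ {q}) := by
  have hxy := h₁.ne
  have huv := h₂.ne
  have h₁' := h₁.symm
  have h₂' := h₂.symm
  have h₃' : ¬ G.Adj u x := fun h => h₃ h.symm
  have h₄' : ¬ G.Adj v y := fun h => h₄ h.symm
  have key : ∀ b, (G ∆ fourCycle x y u v).Adj a b ↔
      (G.Adj a b ↔ s(a, b) ∉ ({s(x, y), s(u, v), s(x, u), s(y, v)} : Set (Sym2 V))) := by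
    intro b
    have : s(a, b) ∈ ({s(x, y), s(u, v), s(x, u), s(y, v)} : Set (Sym2 V)) → a ≠ b := by
      rintro h rfl
      simp only [Set.mem_insert_iff, Set.mem_singleton_iff, Sym2.eq_iff] at h
      grind
    simp only [symmDiff_def, SimpleGraph.sup_adj, SimpleGraph.sdiff_adj, fourCycle,
      SimpleGraph.fromEdgeSet_adj]
    revert this
    generalize (s(a, b) ∈ ({s(x, y), s(u, v), s(x, u), s(y, v)} : Set (Sym2 V))) = P
    tauto
  by_cases hax : a = x
  · subst hax
    refine Or.inr ⟨u, h₃, y, h₁, ?_⟩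
    ext b
    rw [SimpleGraph.mem_neighborSet, key]
    simp only [Set.mem_insert_iff, Set.mem_singleton_iff, Sym2.eq_iff, Set.mem_sdiff,
      SimpleGraph.mem_neighborSet]
    grind
  by_cases hay : a = y
  · subst hay
    refine Or.inr ⟨v, h₄, x, h₁', ?_⟩
    ext b
    rw [SimpleGraph.mem_neighborSet, key]
    simp only [Set.mem_insert_iff, Set.mem_singleton_iff, Sym2.eq_iff, Set.mem_sdiff,
      SimpleGraph.mem_neighborSet]
    grind
  by_cases hau : a = u
  · subst hau
    refine Or.inr ⟨x, h₃', v, h₂, ?_⟩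
    ext b
    rw [SimpleGraph.mem_neighborSet, key]
    simp only [Set.mem_insert_iff, Set.mem_singleton_iff, Sym2.eq_iff, Set.mem_sdiff,
      SimpleGraph.mem_neighborSet]
    grind
  by_cases hav : a = v
  · subst hav
    refine Or.inr ⟨y, h₄', u, h₂', ?_⟩
    ext b
    rw [SimpleGraph.mem_neighborSet, key]
    simp only [Set.mem_insert_iff, Set.mem_singleton_iff, Sym2.eq_iff, Set.mem_sdiff,
      SimpleGraph.mem_neighborSet]
    grind
  left
  ext b
  rw [SimpleGraph.mem_neighborSet, key]
  simp only [Set.mem_insert_iff, Set.mem_singleton_iff, Sym2.eq_iff,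
    SimpleGraph.mem_neighborSet]
  grind

theorem ncard_neighborSet_symmDiff_fourCycle [Finite V] {G : SimpleGraph V} {x y u v : V}
    (hxu : x ≠ u) (hyv : y ≠ v) (hxv : x ≠ v) (hyu : y ≠ u) (h₁ : G.Adj x y) (h₂ : G.Adj u v)
    (h₃ : ¬ G.Adj x u) (h₄ : ¬ G.Adj y v) (a : V) :
    ((G ∆ fourCycle x y u v).neighborSet a).ncard = (G.neighborSet a).ncard := by
  obtain h | ⟨p, hp, q, hq, h⟩ :=
    neighborSet_symmDiff_fourCycle hxu hyv hxv hyu h₁ h₂ h₃ h₄ a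
  · rw [h]
  · rw [h, Set.ncard_exchange hp hq]

variable [Fintype V]

open Classical in
/-- The `d`-regular graphs that contain the edges in `F`. -/
def regularContaining (d : ℕ) (F : Finset (Sym2 V)) : Finset (SimpleGraph V) :=
  {G | (∀ v, (G.neighborSet v).ncard = d) ∧ ↑F ⊆ G.edgeSet}

theorem mem_regularContaining {d : ℕ} {F : Finset (Sym2 V)} {G : SimpleGraph V} :
    G ∈ regularContaining d F ↔ (∀ v, (G.neighborSet v).ncard = d) ∧ ↑F ⊆ G.edgeSet := by
  simp [regularContaining]

open Classical in
/-- The ordered edges `(u, v)` of `G` outside `F` for which the edges `xy`, `uv` can be replaced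
by `xu`, `yv`. -/
def switchable (G : SimpleGraph V) (F : Finset (Sym2 V)) (x y : V) : Finset (V × V) :=
  {p | G.Adj p.1 p.2 ∧ s(p.1, p.2) ∉ F ∧ x ≠ p.1 ∧ ¬ G.Adj x p.1 ∧ y ≠ p.2 ∧ ¬ G.Adj y p.2}

open Classical in
theorem card_filter_mk_mem_le (F : Finset (Sym2 V)) :
    (Finset.univ.filter fun p : V × V => s(p.1, p.2) ∈ F).card ≤ 2 * F.card := by
  refine Finset.card_le_mul_card_image_of_maps_to (f := fun p : V × V => s(p.1, p.2))
    (fun p hp => (Finset.mem_filter.1 hp).2) 2 fun e _ => ?_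
  induction e with
  | h a b =>
    refine (Finset.card_le_card (t := {(a, b), (b, a)}) fun p hp => ?_).trans Finset.card_le_two
    have := (Finset.mem_filter.1 hp).2
    rw [Sym2.eq_iff] at this
    obtain ⟨p, q⟩ := p
    simpa using this

open Classical in
theorem card_filter_adj_and {d : ℕ} {G : SimpleGraph V} (hG : ∀ v, (G.neighborSet v).ncard = d)
    (s : Finset V) :
    (Finset.univ.filter fun p : V × V => G.Adj p.1 p.2 ∧ p.1 ∈ s).card = s.card * d := by
  have h : (Finset.univ.filter fun p : V × V => G.Adj p.1 p.2 ∧ p.1 ∈ s) =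
      s.biUnion fun a => (G.neighborFinset a).map (Function.Embedding.sectR a V) := by
    ext ⟨a, b⟩
    simp [and_comm]
  rw [h, Finset.card_biUnion]
  · simp only [Finset.card_map]
    refine Finset.sum_const_nat fun a _ => ?_
    rw [← hG a, Set.ncard_eq_toFinset_card']
    rfl
  · intro a _ b _ hab
    rw [Function.onFun, Finset.disjoint_left]
    rintro ⟨p, q⟩ h₁ h₂
    simp only [Finset.mem_map, Function.Embedding.sectR_apply, Prod.mk.injEq] at h₁ h₂
    grind

open Classical in
-- Of the `nd` ordered edges, one discards those in `F`, those starting in the closed neighbourhood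
-- of `x`, and those ending in that of `y`.
theorem card_switchable {d : ℕ} {G : SimpleGraph V} (hG : ∀ v, (G.neighborSet v).ncard = d)
    (F : Finset (Sym2 V)) (x y : V) :
    Fintype.card V * d ≤ (switchable G F x y).card + (2 * F.card + 2 * ((d + 1) * d)) := by
  have hN : ∀ z, (insert z (G.neighborFinset z)).card = d + 1 := fun z => by
    rw [Finset.card_insert_of_notMem (by simp), ← hG z, Set.ncard_eq_toFinset_card']
    rfl
  have hA := card_filter_adj_and hG Finset.univ
  have hB := card_filter_adj_and hG (insert x (G.neighborFinset x))
  have hC := card_filter_adj_and hG (insert y (G.neighborFinset y))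
  have hC' : (Finset.univ.filter fun p : V × V =>
      G.Adj p.1 p.2 ∧ p.2 ∈ insert y (G.neighborFinset y)).card = (d + 1) * d := by
    rw [← hN y, ← hC]
    refine Finset.card_bij' (fun p _ => p.swap) (fun p _ => p.swap) ?_ ?_ ?_ ?_ <;>
      simp +contextual [SimpleGraph.adj_comm]
  rw [hN] at hB
  have hD := card_filter_mk_mem_le F
  have hsub : (Finset.univ.filter fun p : V × V => G.Adj p.1 p.2 ∧ p.1 ∈ Finset.univ) ⊆
      switchable G F x y ∪ ((Finset.univ.filter fun p : V × V => s(p.1, p.2) ∈ F) ∪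
        ((Finset.univ.filter fun p : V × V =>
          G.Adj p.1 p.2 ∧ p.1 ∈ insert x (G.neighborFinset x)) ∪
        (Finset.univ.filter fun p : V × V =>
          G.Adj p.1 p.2 ∧ p.2 ∈ insert y (G.neighborFinset y)))) := by
    rintro ⟨u, v⟩ h
    simp only [switchable, Finset.mem_union, Finset.mem_filter, Finset.mem_univ, true_and,
      Finset.mem_insert, SimpleGraph.mem_neighborFinset] at h ⊢
    grind
  have hle := Finset.card_le_card hsub
  rw [hA, Finset.card_univ] at hle
  refine hle.trans ((Finset.card_union_le _ _).trans (Nat.add_le_add_left ?_ _))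
  refine (Finset.card_union_le _ _).trans (add_le_add hD ?_)
  refine (Finset.card_union_le _ _).trans ?_
  rw [hB, hC']
  omega

open Classical in
theorem card_neighbor_product {d : ℕ} {G : SimpleGraph V}
    (hG : ∀ v, (G.neighborSet v).ncard = d) (x y : V) :
    (Finset.univ.filter fun p : V × V => G.Adj x p.1 ∧ G.Adj y p.2).card = d * d := by
  have h : (Finset.univ.filter fun p : V × V => G.Adj x p.1 ∧ G.Adj y p.2) =
      G.neighborFinset x ×ˢ G.neighborFinset y := by
    ext ⟨a, b⟩
    simp
  rw [h, Finset.card_product]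
  congr 1
  · rw [← hG x, Set.ncard_eq_toFinset_card']; rfl
  · rw [← hG y, Set.ncard_eq_toFinset_card']; rfl

open Classical in
theorem symmDiff_fourCycle_mem {d : ℕ} {F : Finset (Sym2 V)} {x y : V} (hF : s(x, y) ∉ F)
    {G : SimpleGraph V} (hG : G ∈ regularContaining d (insert s(x, y) F)) {p : V × V}
    (hp : p ∈ switchable G F x y) :
    G ∆ fourCycle x y p.1 p.2 ∈ regularContaining d F ∧
      (G ∆ fourCycle x y p.1 p.2).Adj x p.1 ∧ (G ∆ fourCycle x y p.1 p.2).Adj y p.2 := by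
  obtain ⟨u, v⟩ := p
  simp only [switchable, Finset.mem_filter, Finset.mem_univ, true_and] at hp
  obtain ⟨huv, huvF, hxu, hnxu, hyv, hnyv⟩ := hp
  rw [mem_regularContaining, Finset.coe_insert, Set.insert_subset_iff] at hG
  obtain ⟨hreg, hxy, hFG⟩ := hG
  rw [SimpleGraph.mem_edgeSet] at hxy
  have hyu : y ≠ u := fun h => hnxu (h ▸ hxy)
  have hxv : x ≠ v := fun h => hnyv (h ▸ hxy.symm)
  refine ⟨mem_regularContaining.2 ⟨fun a => ?_, fun e he => ?_⟩, ?_, ?_⟩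
  · rw [ncard_neighborSet_symmDiff_fourCycle hxu hyv hxv hyu hxy huv hnxu hnyv, hreg]
  · have heG := hFG he
    induction e with
    | h a b =>
      have h₁ : s(a, b) ≠ s(x, y) := fun h => hF (h ▸ he)
      have h₂ : s(a, b) ≠ s(u, v) := fun h => huvF (h ▸ he)
      have h₃ : s(a, b) ≠ s(x, u) := fun h => hnxu (by
        rw [h] at heG; exact heG)
      have h₄ : s(a, b) ≠ s(y, v) := fun h => hnyv (by
        rw [h] at heG; exact heG)
      rw [SimpleGraph.mem_edgeSet] at heG ⊢
      simp only [symmDiff_def, SimpleGraph.sup_adj, SimpleGraph.sdiff_adj, fourCycle,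
        SimpleGraph.fromEdgeSet_adj, Set.mem_insert_iff, Set.mem_singleton_iff]
      tauto
  · simp only [symmDiff_def, SimpleGraph.sup_adj, SimpleGraph.sdiff_adj, fourCycle,
      SimpleGraph.fromEdgeSet_adj, Set.mem_insert_iff, Set.mem_singleton_iff]
    tauto
  · simp only [symmDiff_def, SimpleGraph.sup_adj, SimpleGraph.sdiff_adj, fourCycle,
      SimpleGraph.fromEdgeSet_adj, Set.mem_insert_iff, Set.mem_singleton_iff]
    tauto

open Classical in
-- Switching is undone by the same symmetric difference, so the result and `(u, v)` determine `G`.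
-- In the result `u` is a neighbour of `x` and `v` one of `y`, leaving `d * d` pairs.
theorem sum_card_switchable_le {d : ℕ} {F : Finset (Sym2 V)} {x y : V} (hF : s(x, y) ∉ F) :
    ∑ G ∈ regularContaining d (insert s(x, y) F), (switchable G F x y).card ≤
      (regularContaining d F).card * (d * d) := by
  have h : ∑ G ∈ regularContaining d F,
      (Finset.univ.filter fun p : V × V => G.Adj x p.1 ∧ G.Adj y p.2).card =
        (regularContaining d F).card * (d * d) :=
    Finset.sum_const_nat fun G hG => card_neighbor_product (mem_regularContaining.1 hG).1 x y
  rw [← h, ← Finset.card_sigma, ← Finset.card_sigma]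
  refine Finset.card_le_card_of_injOn
    (fun a => ⟨a.1 ∆ fourCycle x y a.2.1 a.2.2, a.2⟩) ?_ ?_
  · rintro ⟨G, p⟩ ha
    simp only [Finset.coe_sigma, Set.mem_sigma_iff, Finset.mem_coe] at ha
    simpa using symmDiff_fourCycle_mem hF ha.1 ha.2
  · rintro ⟨G, p⟩ _ ⟨G', p'⟩ _ h
    simp only [Sigma.mk.injEq, heq_eq_eq] at h
    obtain ⟨h, rfl⟩ := h
    rw [symmDiff_left_injective _ h]

open Classical in
-- By `hn` at least half of the `nd` ordered edges are switchable; double counting of switchings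
-- gives the factor `2d/n`.
theorem card_regularContaining_insert_le {d : ℕ} (hd : 0 < d) {F : Finset (Sym2 V)}
    {e : Sym2 V} (he : e ∉ F)
    (hn : 4 * F.card + 4 * ((d + 1) * d) ≤ Fintype.card V * d) :
    (regularContaining d (insert e F)).card * Fintype.card V ≤
      2 * d * (regularContaining d F).card := by
  induction e with
  | h x y =>
    have h₁ := sum_card_switchable_le (d := d) he
    have h₂ : (regularContaining d (insert s(x, y) F)).card * (Fintype.card V * d) ≤
        ∑ G ∈ regularContaining d (insert s(x, y) F),
          ((switchable G F x y).card + (2 * F.card + 2 * ((d + 1) * d))) := by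
      rw [← smul_eq_mul]
      exact Finset.card_nsmul_le_sum _ _ _ fun G hG =>
        card_switchable (mem_regularContaining.1 hG).1 F x y
    rw [Finset.sum_add_distrib, Finset.sum_const, smul_eq_mul] at h₂
    set R := (regularContaining d (insert s(x, y) F)).card
    set R' := (regularContaining d F).card
    have h₃ : R * (4 * F.card + 4 * ((d + 1) * d)) ≤ R * (Fintype.card V * d) :=
      Nat.mul_le_mul_left _ hn
    refine Nat.le_of_mul_le_mul_right ?_ hd
    nlinarith

open Classical in
theorem card_regularContaining_le {d : ℕ} (hd : 0 < d) (F : Finset (Sym2 V))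
    (hn : 4 * F.card + 4 * ((d + 1) * d) ≤ Fintype.card V * d) :
    (regularContaining d F).card * Fintype.card V ^ F.card ≤
      (2 * d) ^ F.card * (regularContaining d (∅ : Finset (Sym2 V))).card := by
  induction F using Finset.induction_on with
  | empty => simp
  | insert e F he ih =>
    rw [Finset.card_insert_of_notMem he] at hn ⊢
    have h₁ := card_regularContaining_insert_le hd he (by omega)
    have h₂ := ih (by omega)
    calc _ = (regularContaining d (insert e F)).card * Fintype.card V *
          Fintype.card V ^ F.card := by ring
      _ ≤ 2 * d * (regularContaining d F).card * Fintype.card V ^ F.card :=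
          Nat.mul_le_mul_right _ h₁
      _ = 2 * d * ((regularContaining d F).card * Fintype.card V ^ F.card) := by ring
      _ ≤ 2 * d * ((2 * d) ^ F.card * (regularContaining d (∅ : Finset (Sym2 V))).card) :=
          Nat.mul_le_mul_left _ h₂
      _ = _ := by ring

end Switching

/-! ### Union bound: small vertex sets span few edges. -/

section UnionBound

theorem choose_le_exp_mul_div_pow (N : ℕ) {m : ℕ} (hm : 0 < m) :
    (N.choose m : ℝ) ≤ (N * Real.exp 1 / m) ^ m := by
  have h₁ : (N.choose m : ℝ) ≤ (N : ℝ) ^ m / m.factorial := Nat.choose_le_pow_div m N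
  have h₂ := Real.pow_div_factorial_le_exp (m : ℝ) m.cast_nonneg m
  have hm' : (0 : ℝ) < m := by exact_mod_cast hm
  have hf : (0 : ℝ) < m.factorial := by exact_mod_cast m.factorial_pos
  refine h₁.trans ?_
  rw [div_pow, mul_pow, ← Real.exp_nat_mul, mul_one, div_le_div_iff₀ hf (by positivity), mul_assoc]
  refine mul_le_mul_of_nonneg_left ?_ (by positivity)
  rwa [div_le_iff₀ hf] at h₂

/-- The constant of the union bound over small sets of vertices. -/
def unionConst (d : ℕ) : ℝ := Real.exp 1 * (2 * d * Real.exp 1) ^ 3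

theorem unionConst_ge {d : ℕ} (hd : 0 < d) : 12 ≤ unionConst d := by
  have he : (2 : ℝ) ≤ Real.exp 1 := by linarith [Real.add_one_le_exp (1 : ℝ)]
  have hd' : (1 : ℝ) ≤ d := by exact_mod_cast hd
  have h : (4 : ℝ) ≤ 2 * d * Real.exp 1 := by nlinarith
  have h3 : (4 : ℝ) ^ 3 ≤ (2 * d * Real.exp 1) ^ 3 := pow_le_pow_left₀ (by norm_num) h 3
  unfold unionConst
  nlinarith

theorem union_term_le {d n k q : ℕ} (hd : 0 < d) (hk : 0 < k) (hn : 0 < n) :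
    (n.choose k : ℝ) * ((k ^ 2).choose (k + k / q + 1) : ℝ) * (2 * d / n) ^ (k + k / q + 1) ≤
      unionConst d ^ k * ((k : ℝ) / n) ^ (k / q + 1) := by
  have hk' : (0 : ℝ) < k := by exact_mod_cast hk
  have hn' : (0 : ℝ) < n := by exact_mod_cast hn
  have hd' : (1 : ℝ) ≤ d := by exact_mod_cast hd
  have he : (1 : ℝ) ≤ Real.exp 1 := by linarith [Real.add_one_le_exp (1 : ℝ)]
  set m := k + k / q + 1 with hm
  have hkm : k ≤ m := (Nat.le_add_right _ _).trans (Nat.le_succ _)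
  -- This uses `k ≥ 1` and is the source of the cube in `unionConst`.
  have hm3 : m ≤ 3 * k := by have := Nat.div_le_self k q; omega
  have h₁ := choose_le_exp_mul_div_pow n hk
  have h₂ : ((k ^ 2).choose m : ℝ) ≤ (k * Real.exp 1) ^ m := by
    refine (choose_le_exp_mul_div_pow _ (hk.trans_le hkm)).trans
      (pow_le_pow_left₀ (by positivity) ?_ m)
    have : (k : ℝ) ≤ m := by exact_mod_cast hkm
    rw [div_le_iff₀ (by linarith)]
    push_cast
    nlinarith [mul_le_mul_of_nonneg_left this (by positivity : (0 : ℝ) ≤ k * Real.exp 1)]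
  calc _ ≤ (n * Real.exp 1 / k) ^ k * (k * Real.exp 1) ^ m * (2 * d / n) ^ m := by gcongr
    _ = Real.exp 1 ^ k * (2 * d * Real.exp 1) ^ m * (k / n : ℝ) ^ (k / q + 1) := by
        have hmk : m = k + (k / q + 1) := by omega
        have h₃ : (k * Real.exp 1 : ℝ) ^ m * (2 * d / n) ^ m =
            (2 * d * Real.exp 1) ^ m * ((k / n : ℝ) ^ k * (k / n : ℝ) ^ (k / q + 1)) := by
          rw [← pow_add, ← hmk, ← mul_pow, ← mul_pow]
          congr 1
          ring
        have h₄ : (n * Real.exp 1 / k : ℝ) ^ k * (k / n : ℝ) ^ k = Real.exp 1 ^ k := by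
          rw [← mul_pow]
          congr 1
          field_simp
        rw [mul_assoc, h₃, ← h₄]
        ring
    _ ≤ Real.exp 1 ^ k * (2 * d * Real.exp 1) ^ (3 * k) * (k / n : ℝ) ^ (k / q + 1) := by
        gcongr
        nlinarith
    _ = _ := by rw [pow_mul, ← mul_pow]; rfl

variable {V : Type*}

/-- Every set of at most `η |V|` vertices spans at most `1 + 1 / q` edges per vertex. -/
def IsSparse [Fintype V] (G : SimpleGraph V) (η : ℝ) (q : ℕ) : Prop :=
  ∀ S : Finset V, (S.card : ℝ) ≤ η * Fintype.card V →
    ∀ F : Finset (Sym2 V), F ⊆ S.sym2 → ↑F ⊆ G.edgeSet → F.card ≤ S.card + S.card / q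

variable [Fintype V]

/-- The summand of the union bound that belongs to sets of `k` vertices among `n`. -/
def unionTerm (d q : ℕ) (η : ℝ) (n k : ℕ) : ℝ :=
  open Classical in
  if 0 < k ∧ (k : ℝ) ≤ η * n then unionConst d ^ k * ((k : ℝ) / n) ^ (k / q + 1) else 0

theorem unionTerm_nonneg {d q : ℕ} {η : ℝ} {n k : ℕ} : 0 ≤ unionTerm d q η n k := by
  unfold unionTerm unionConst
  split_ifs <;> positivity

open Classical in
theorem card_regularContaining_le_real {d : ℕ} (hd : 0 < d) (F : Finset (Sym2 V))
    (hV : 0 < Fintype.card V) (hn : 4 * F.card + 4 * ((d + 1) * d) ≤ Fintype.card V * d) :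
    ((regularContaining d F).card : ℝ) ≤ (2 * d / Fintype.card V) ^ F.card *
      (regularContaining d (∅ : Finset (Sym2 V))).card := by
  have h := card_regularContaining_le hd F hn
  have hV' : (0 : ℝ) < Fintype.card V := by exact_mod_cast hV
  have h' : ((regularContaining d F).card : ℝ) * (Fintype.card V : ℝ) ^ F.card ≤
    (2 * d) ^ F.card * (regularContaining d (∅ : Finset (Sym2 V))).card := by exact_mod_cast h
  rw [div_pow, div_mul_eq_mul_div, le_div_iff₀ (by positivity)]
  exact h'

open Classical in
theorem card_not_isSparse_le {d q : ℕ} {η : ℝ} (hd : 0 < d) (hη : 24 * η ≤ 1)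
    (hV : 8 * (d + 1) ≤ Fintype.card V) :
    (((regularContaining d (∅ : Finset (Sym2 V))).filter
      fun G => ¬ IsSparse G η q).card : ℝ) ≤
      (∑ k ∈ Finset.range (Fintype.card V + 1), unionTerm d q η (Fintype.card V) k) *
        (regularContaining d (∅ : Finset (Sym2 V))).card := by
  set n := Fintype.card V with hn
  set R := regularContaining d (∅ : Finset (Sym2 V)) with hR
  have hn0 : 0 < n := by omega
  set K := (Finset.range (n + 1)).filter fun k : ℕ => 0 < k ∧ (k : ℝ) ≤ η * n with hK
  have hsub : (R.filter fun G => ¬ IsSparse G η q) ⊆ K.biUnion fun k =>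
      (Finset.powersetCard k (Finset.univ : Finset V)).biUnion fun S =>
        (Finset.powersetCard (k + k / q + 1) S.sym2).biUnion fun F => regularContaining d F := by
    intro G hG
    rw [Finset.mem_filter, hR, mem_regularContaining, IsSparse] at hG
    obtain ⟨⟨hreg, -⟩, hG⟩ := hG
    push Not at hG
    obtain ⟨S, hS, F, hFS, hFG, hF⟩ := hG
    -- Trimming to exactly one edge too many fixes the size in the union bound.
    obtain ⟨F', hF'F, hF'⟩ := Finset.exists_subset_card_eq (Nat.succ_le_of_lt hF)
    simp only [Finset.mem_biUnion, Finset.mem_powersetCard, mem_regularContaining]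
    refine ⟨S.card, ?_, S, ⟨S.subset_univ, rfl⟩, F', ⟨hF'F.trans hFS, hF'⟩, hreg,
      (Finset.coe_subset.2 hF'F).trans hFG⟩
    rw [hK, Finset.mem_filter, Finset.mem_range, Finset.card_pos, Nat.lt_succ_iff]
    refine ⟨S.card_le_univ, Finset.nonempty_iff_ne_empty.2 fun h => ?_, hS⟩
    subst h
    have := Finset.card_le_card hFS
    rw [Finset.sym2_empty, Finset.card_empty, Nat.le_zero] at this
    exact Nat.not_lt_zero _ (this ▸ hF)
  have hterm : ∀ k ∈ K, ((((Finset.powersetCard k (Finset.univ : Finset V)).biUnion fun S =>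
      (Finset.powersetCard (k + k / q + 1) S.sym2).biUnion fun F =>
        regularContaining d F).card : ℕ) : ℝ) ≤ unionTerm d q η n k * R.card := by
    intro k hk
    rw [hK, Finset.mem_filter] at hk
    obtain ⟨-, hk0, hkη⟩ := hk
    set m := k + k / q + 1 with hm
    have hm3 : m ≤ 3 * k := by have := Nat.div_le_self k q; omega
    -- Each summand is at most `nd/2`: the first since `4m ≤ 12k ≤ n/2`, the second by `hV`.
    have hmn : 4 * m + 4 * ((d + 1) * d) ≤ n * d := by
      have h1 : (24 : ℝ) * k ≤ n := by nlinarith [(Nat.cast_nonneg n : (0 : ℝ) ≤ n)]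
      have h2 : 24 * k ≤ n := by exact_mod_cast h1
      nlinarith
    have hinner : ∀ S ∈ Finset.powersetCard k (Finset.univ : Finset V),
        ((((Finset.powersetCard m S.sym2).biUnion fun F =>
          regularContaining d F).card : ℕ) : ℝ) ≤
            ((k ^ 2).choose m : ℝ) * ((2 * d / n) ^ m * R.card) := by
      intro S hS
      rw [Finset.mem_powersetCard] at hS
      have h1 : ((((Finset.powersetCard m S.sym2).biUnion fun F =>
          regularContaining d F).card : ℕ) : ℝ) ≤
            ∑ F ∈ Finset.powersetCard m S.sym2, ((regularContaining d F).card : ℝ) := by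
        exact_mod_cast Finset.card_biUnion_le
      refine h1.trans ?_
      have h2 : ∀ F ∈ Finset.powersetCard m S.sym2, ((regularContaining d F).card : ℝ) ≤
          (2 * d / n) ^ m * R.card := by
        intro F hF
        rw [Finset.mem_powersetCard] at hF
        have := card_regularContaining_le_real hd F hn0 (by rw [hF.2]; exact hmn)
        rwa [hF.2] at this
      refine (Finset.sum_le_card_nsmul _ _ _ h2).trans ?_
      rw [nsmul_eq_mul, Finset.card_powersetCard, Finset.card_sym2, hS.2]
      refine mul_le_mul_of_nonneg_right ?_ (by positivity)
      norm_cast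
      -- `S.sym2` includes the diagonal, so it has `k(k+1)/2 ≤ k²` elements.
      refine Nat.choose_le_choose m ?_
      rw [Nat.choose_two_right, Nat.add_sub_cancel]
      refine Nat.div_le_of_le_mul ?_
      nlinarith
    have h1 : ((((Finset.powersetCard k (Finset.univ : Finset V)).biUnion fun S =>
        (Finset.powersetCard m S.sym2).biUnion fun F => regularContaining d F).card : ℕ) : ℝ) ≤
          ∑ S ∈ Finset.powersetCard k (Finset.univ : Finset V),
            ((((Finset.powersetCard m S.sym2).biUnion fun F =>
              regularContaining d F).card : ℕ) : ℝ) := by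
      exact_mod_cast Finset.card_biUnion_le
    refine (h1.trans (Finset.sum_le_card_nsmul _ _ _ hinner)).trans ?_
    rw [nsmul_eq_mul, Finset.card_powersetCard, Finset.card_univ, ← hn, ← mul_assoc, ← mul_assoc]
    refine mul_le_mul_of_nonneg_right ?_ (by positivity)
    rw [unionTerm, if_pos ⟨hk0, hkη⟩]
    exact union_term_le hd hk0 hn0
  have hcard : (((R.filter fun G => ¬ IsSparse G η q).card : ℕ) : ℝ) ≤
      ∑ k ∈ K, ((((Finset.powersetCard k (Finset.univ : Finset V)).biUnion fun S =>
        (Finset.powersetCard (k + k / q + 1) S.sym2).biUnion fun F =>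
          regularContaining d F).card : ℕ) : ℝ) := by
    exact_mod_cast (Finset.card_le_card hsub).trans Finset.card_biUnion_le
  refine hcard.trans ((Finset.sum_le_sum hterm).trans ?_)
  rw [← Finset.sum_mul]
  refine mul_le_mul_of_nonneg_right ?_ (by positivity)
  exact Finset.sum_le_sum_of_subset_of_nonneg (Finset.filter_subset _ _)
    fun _ _ _ => unionTerm_nonneg

/-- The density below which sets of vertices count as small. -/
def smallDensity (d q : ℕ) : ℝ := (1 / (2 * unionConst d)) ^ q

theorem smallDensity_pos {d : ℕ} (hd : 0 < d) (q : ℕ) : 0 < smallDensity d q := by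
  have := unionConst_ge hd
  unfold smallDensity
  positivity

theorem smallDensity_le {d : ℕ} (hd : 0 < d) {q : ℕ} (hq : 0 < q) :
    24 * smallDensity d q ≤ 1 := by
  have h := unionConst_ge hd
  have h₁ : 1 / (2 * unionConst d) ≤ 1 / 24 := one_div_le_one_div_of_le (by norm_num) (by linarith)
  have h₂ : smallDensity d q ≤ 1 / (2 * unionConst d) :=
    pow_le_of_le_one (by positivity) (by linarith) hq.ne'
  linarith

theorem unionTerm_le {d q : ℕ} (hd : 0 < d) (hq : 0 < q) (n k : ℕ) :
    unionTerm d q (smallDensity d q) n k ≤ (1 / 2) ^ k := by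
  unfold unionTerm
  split_ifs with h
  swap
  · positivity
  obtain ⟨hk, hkn⟩ := h
  have hC := unionConst_ge hd
  set r := 1 / (2 * unionConst d) with hr
  have hr0 : 0 < r := by positivity
  have hr1 : r ≤ 1 := by rw [hr, div_le_one (by positivity)]; linarith
  have hn : (0 : ℝ) < n := by
    have hk' : (0 : ℝ) < k := by exact_mod_cast hk
    have := smallDensity_pos hd q
    by_contra hn
    nlinarith
  -- The density is `r ^ q`, and `q * (k / q + 1)` exceeds `k` despite the rounding.
  have h₁ : ((k : ℝ) / n) ^ (k / q + 1) ≤ r ^ k := by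
    calc _ ≤ (r ^ q) ^ (k / q + 1) :=
          pow_le_pow_left₀ (by positivity) ((div_le_iff₀ hn).2 hkn) _
      _ = r ^ (q * (k / q + 1)) := by rw [pow_mul]
      _ ≤ r ^ k := pow_le_pow_of_le_one hr0.le hr1 (Nat.lt_mul_div_succ k hq).le
  calc _ ≤ unionConst d ^ k * r ^ k := by gcongr
    _ = (1 / 2) ^ k := by
        rw [← mul_pow, hr]
        congr 1
        field_simp

/-- Each fixed `k` contributes a vanishing term and `(1/2) ^ k` dominates, so dominated convergence
applies. -/
theorem tendsto_sum_unionTerm {d q : ℕ} (hd : 0 < d) (hq : 0 < q) :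
    Tendsto (fun n : ℕ => ∑ k ∈ Finset.range (n + 1), unionTerm d q (smallDensity d q) n k)
      atTop (𝓝 0) := by
  have hsum : Summable fun k : ℕ => (1 / 2 : ℝ) ^ k :=
    summable_geometric_of_lt_one (by norm_num) (by norm_num)
  have htend : Tendsto (fun n : ℕ => ∑' k, unionTerm d q (smallDensity d q) n k) atTop
      (𝓝 (∑' _ : ℕ, (0 : ℝ))) := by
    refine tendsto_tsum_of_dominated_convergence hsum (fun k => ?_)
      (Eventually.of_forall fun n k => ?_)
    · have hlim : Tendsto (fun n : ℕ => unionConst d ^ k * ((k : ℝ) / n) ^ (k / q + 1)) atTop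
          (𝓝 0) := by
        have h := ((tendsto_const_div_atTop_nhds_zero_nat (k : ℝ)).pow (k / q + 1)).const_mul
          (unionConst d ^ k)
        simpa using h
      refine squeeze_zero (fun n => unionTerm_nonneg) (fun n => ?_) hlim
      unfold unionTerm
      have := unionConst_ge hd
      split_ifs
      · exact le_rfl
      · positivity
    · rw [Real.norm_of_nonneg unionTerm_nonneg]
      exact unionTerm_le hd hq n k
  rw [tsum_zero] at htend
  refine squeeze_zero (fun n => Finset.sum_nonneg fun _ _ => unionTerm_nonneg) (fun n => ?_) htend
  refine Summable.sum_le_tsum _ (fun _ _ => unionTerm_nonneg) ?_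
  exact hsum.of_nonneg_of_le (fun _ => unionTerm_nonneg) (unionTerm_le hd hq n)

end UnionBound

/-! ### Existence of regular graphs, via circulant graphs. -/

section Existence

theorem ncard_neighborSet_circulantGraph {A : Type*} [AddGroup A] {s : Set A}
    (h₀ : (0 : A) ∉ s) (hs : ∀ a ∈ s, -a ∈ s) (v : A) :
    ((SimpleGraph.circulantGraph s).neighborSet v).ncard = s.ncard := by
  have h : (SimpleGraph.circulantGraph s).neighborSet v = (fun a => a + v) '' s := by
    ext w
    simp only [SimpleGraph.mem_neighborSet, SimpleGraph.circulantGraph,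
      SimpleGraph.fromRel_adj, Set.mem_image]
    constructor
    · rintro ⟨-, h | h⟩
      · exact ⟨w - v, by simpa using hs _ h, by simp⟩
      · exact ⟨w - v, h, by simp⟩
    · rintro ⟨a, ha, rfl⟩
      refine ⟨fun h => h₀ ?_, Or.inr (by simpa using ha)⟩
      rw [eq_comm, add_eq_right] at h
      exact h ▸ ha
  rw [h, Set.ncard_image_of_injective _ (add_left_injective v)]

/-- Take the residues `±1, …, ±j`; for odd `d` the order `n` is even and `n / 2`, its own negative,
is added. -/
theorem exists_symmetric_subset {n d : ℕ} (hdn : d < n) (hnd : Even (n * d)) :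
    ∃ T : Finset ℕ, T.card = d ∧ ∀ i ∈ T, 0 < i ∧ i < n ∧ n - i ∈ T := by
  have hcard : ∀ j, 2 * j < n →
      (Finset.Icc 1 j ∪ Finset.Icc (n - j) (n - 1)).card = 2 * j := fun j hj => by
    rw [Finset.card_union_of_disjoint, Nat.card_Icc, Nat.card_Icc]
    · omega
    · rw [Finset.disjoint_left]
      intro i h₁ h₂
      rw [Finset.mem_Icc] at h₁ h₂
      omega
  obtain ⟨j, rfl | rfl⟩ := d.even_or_odd'
  · refine ⟨Finset.Icc 1 j ∪ Finset.Icc (n - j) (n - 1), hcard j hdn, fun i hi => ?_⟩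
    simp only [Finset.mem_union, Finset.mem_Icc] at hi ⊢
    omega
  · obtain ⟨h, rfl⟩ : ∃ h, n = 2 * h := by
      rw [Nat.even_mul] at hnd
      obtain ⟨h, rfl⟩ := hnd.resolve_right (by simp)
      exact ⟨h, by ring⟩
    refine ⟨insert h (Finset.Icc 1 j ∪ Finset.Icc (2 * h - j) (2 * h - 1)), ?_, fun i hi => ?_⟩
    · rw [Finset.card_insert_of_notMem, hcard j (by omega)]
      simp only [Finset.mem_union, Finset.mem_Icc]
      omega
    · simp only [Finset.mem_union, Finset.mem_Icc, Finset.mem_insert] at hi ⊢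
      omega

theorem exists_regular_graph {n d : ℕ} (hdn : d < n) (hnd : Even (n * d)) :
    ∃ G : SimpleGraph (Fin n), ∀ v, (G.neighborSet v).ncard = d := by
  obtain ⟨T, hTd, hT⟩ := exists_symmetric_subset hdn hnd
  obtain ⟨m, rfl⟩ : ∃ m, n = m + 1 := ⟨n - 1, by omega⟩
  let s : Set (Fin (m + 1)) := {a | (a : ℕ) ∈ T}
  refine ⟨SimpleGraph.circulantGraph s, fun v => ?_⟩
  rw [ncard_neighborSet_circulantGraph]
  · rw [← hTd, ← Set.ncard_coe_finset T, ← Set.ncard_image_of_injective s Fin.val_injective]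
    congr 1
    ext i
    simp only [Set.mem_image, Finset.mem_coe]
    exact ⟨fun ⟨a, ha, h⟩ => h ▸ ha, fun hi => ⟨⟨i, (hT i hi).2.1⟩, hi, rfl⟩⟩
  · exact fun h => (hT _ h).1.ne rfl
  · intro a ha
    have h := hT _ ha
    change ((-a : Fin (m + 1)) : ℕ) ∈ T
    rw [Fin.val_neg, if_neg (by rintro rfl; exact h.1.ne rfl)]
    exact h.2.2

end Existence

/-! ### From sparsity to long cycles. -/

section LargeCycles

variable {V : Type*} [Fintype V]

open Classical in
-- The cycles partition `V` into small sets; sparsity is applied to each and summed.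
theorem card_isInternal_le {G : SimpleGraph V} {η : ℝ} {q : ℕ} (hG : IsSparse G η q)
    {σ : Equiv.Perm V} (hσ : σ ∉ hasLargeCycle V η) :
    ((G.edgeFinset.filter (IsInternal σ)).card : ℝ) ≤ (1 + 1 / q) * Fintype.card V := by
  let S : Quotient (Equiv.Perm.SameCycle.setoid σ) → Finset V := fun c =>
    Finset.univ.filter fun x => cycleClass σ x = c
  have hS : ∀ c, ((S c).card : ℝ) ≤ η * Fintype.card V := by
    intro c
    obtain ⟨x, rfl⟩ := cycleClass_surjective σ c
    by_contra h
    refine hσ ⟨x, ?_⟩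
    push Not at h
    rw [Nat.card_eq_fintype_card, Nat.card_eq_fintype_card, Fintype.card_subtype]
    have hx : (Finset.univ.filter fun y => σ.SameCycle x y) = S (cycleClass σ x) := by
      ext y
      simp only [S, Finset.mem_filter, Finset.mem_univ, true_and, cycleClass_eq_iff]
      exact Equiv.Perm.sameCycle_comm
    rwa [hx]
  have hsub : G.edgeFinset.filter (IsInternal σ) ⊆
      Finset.univ.biUnion fun c => G.edgeFinset.filter (· ∈ (S c).sym2) := by
    intro e he
    induction e with
    | h x y =>
      rw [Finset.mem_filter, isInternal_mk] at he
      simp only [Finset.mem_biUnion, Finset.mem_univ, true_and, Finset.mem_filter,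
        Finset.mk_mem_sym2_iff, S]
      exact ⟨cycleClass σ x, he.1, rfl, (cycleClass_eq_iff.2 he.2).symm⟩
  have hle : ∀ c, ((G.edgeFinset.filter (· ∈ (S c).sym2)).card : ℝ) ≤
      (1 + 1 / q) * (S c).card := by
    intro c
    have h := hG (S c) (hS c) (G.edgeFinset.filter (· ∈ (S c).sym2))
      (fun e he => (Finset.mem_filter.1 he).2)
      (fun e he => SimpleGraph.mem_edgeFinset.1 (Finset.mem_filter.1 he).1)
    have h' : ((G.edgeFinset.filter (· ∈ (S c).sym2)).card : ℝ) ≤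
        (S c).card + ((S c).card / q : ℕ) := by exact_mod_cast h
    refine h'.trans ?_
    have := Nat.cast_div_le (α := ℝ) (m := (S c).card) (n := q)
    rw [add_mul, one_mul, one_div_mul_eq_div]
    linarith
  have hsum : ∑ c, (S c).card = Fintype.card V := by
    rw [← Finset.card_univ]
    exact (Finset.card_eq_sum_card_fiberwise fun x _ => Finset.mem_univ (cycleClass σ x)).symm
  have hcard : ((G.edgeFinset.filter (IsInternal σ)).card : ℝ) ≤
      ∑ c, ((G.edgeFinset.filter (· ∈ (S c).sym2)).card : ℝ) := by
    exact_mod_cast (Finset.card_le_card hsub).trans Finset.card_biUnion_le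
  refine hcard.trans ((Finset.sum_le_sum fun c _ => hle c).trans_eq ?_)
  rw [← Finset.mul_sum, ← Nat.cast_sum, hsum]

open Classical in
theorem two_mul_card_edgeFinset {d : ℕ} {G : SimpleGraph V}
    (hreg : ∀ v, (G.neighborSet v).ncard = d) :
    2 * (G.edgeFinset.card : ℝ) = d * Fintype.card V := by
  have h := G.sum_degrees_eq_twice_card_edges
  have h' : ∑ v, G.degree v = Fintype.card V * d := by
    rw [← Finset.card_univ]
    refine Finset.sum_const_nat fun v _ => ?_
    rw [← hreg v, Set.ncard_eq_toFinset_card']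
    rfl
  rw [h'] at h
  rw [mul_comm (d : ℝ)]
  exact_mod_cast h.symm

variable [DecidableEq V]

/-- The drift inequality: unless long cycles have positive probability, the entropy `|V| log θ` of
the initial condition is used up before time `t`. -/
theorem permProb_hasLargeCycle_ge [Nonempty V] {G : SimpleGraph V} {η : ℝ} {q k d : ℕ}
    (hG : IsSparse G η q) (hreg : ∀ v, (G.neighborSet v).ncard = d) (hk : 1 ≤ k) {t : ℝ}
    (ht : 0 ≤ t) :
    -Real.log k ≤ t * ((1 - 1 / (k : ℝ)) * (((k : ℝ) + 1) * (1 + 1 / q) - d / 2 +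
      ((k : ℝ) + 1) * (d / 2) * permProb G k t (hasLargeCycle V η))) := by
  classical
  set A := hasLargeCycle V η with hA
  set Z := partitionFunction G k t with hZ
  have hZ1 : 1 ≤ Z := partitionFunction_ge_one G hk ht
  have hZ0 : 0 < Z := by linarith
  set N : ℝ := (Fintype.card V : ℝ) with hN
  have hN0 : 0 < N := by rw [hN]; exact_mod_cast Fintype.card_pos
  have hk1 : (1 : ℝ) ≤ k := by exact_mod_cast hk
  have hθ : 0 ≤ 1 - 1 / (k : ℝ) := by
    rw [sub_nonneg, div_le_one (by linarith)]
    exact hk1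
  have hE : (G.edgeFinset.card : ℝ) = d / 2 * N := by
    have := two_mul_card_edgeFinset hreg
    linarith
  have hpZ : ∑ σ, law G t σ * (k : ℝ) ^ numCycles σ * A.indicator 1 σ =
      permProb G k t A * Z := by
    rw [permProb, div_mul_cancel₀ _ hZ0.ne']
  -- On `A` all edges are allowed to be internal, which costs only a multiple of the probability of
  -- `A`.
  have hI : ∀ σ, ((G.edgeFinset.filter (IsInternal σ)).card : ℝ) ≤
      (1 + 1 / q) * N + d / 2 * N * A.indicator 1 σ := by
    intro σ
    by_cases hσ : σ ∈ A
    · rw [Set.indicator_of_mem hσ, Pi.one_apply, mul_one, ← hE]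
      have : ((G.edgeFinset.filter (IsInternal σ)).card : ℝ) ≤ G.edgeFinset.card := by
        exact_mod_cast Finset.card_filter_le _ _
      have : 0 ≤ (1 + 1 / (q : ℝ)) * N := by positivity
      linarith
    · rw [Set.indicator_of_notMem hσ, mul_zero, add_zero]
      exact card_isInternal_le hG hσ
  have hW : ∑ σ, law G t σ * ∑ e ∈ G.edgeFinset,
      ((k : ℝ) ^ numCycles (transposition e * σ) - (k : ℝ) ^ numCycles σ) ≤
        (1 - 1 / (k : ℝ)) * (((k : ℝ) + 1) * (1 + 1 / q) - d / 2 +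
          ((k : ℝ) + 1) * (d / 2) * permProb G k t A) * N * Z := by
    calc _ ≤ ∑ σ, (law G t σ * (k : ℝ) ^ numCycles σ * ((1 - 1 / (k : ℝ)) *
              ((((k : ℝ) + 1) * (1 + 1 / q) - d / 2) * N)) +
            law G t σ * (k : ℝ) ^ numCycles σ * A.indicator 1 σ * ((1 - 1 / (k : ℝ)) *
              (((k : ℝ) + 1) * (d / 2) * N))) := by
          refine Finset.sum_le_sum fun σ _ => ?_
          refine (mul_le_mul_of_nonneg_left (sum_pow_numCycles_transposition_le hk1 σ _)
            (law_nonneg G ht σ)).trans ?_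
          have h₁ : ((k : ℝ) + 1) * (G.edgeFinset.filter (IsInternal σ)).card -
              G.edgeFinset.card ≤ ((k : ℝ) + 1) * ((1 + 1 / q) * N +
                d / 2 * N * A.indicator 1 σ) - d / 2 * N := by
            rw [hE]
            have := mul_le_mul_of_nonneg_left (hI σ) (by linarith : (0 : ℝ) ≤ (k : ℝ) + 1)
            linarith
          have h₂ := mul_le_mul_of_nonneg_left (mul_le_mul_of_nonneg_left
            (mul_le_mul_of_nonneg_left h₁ hθ) (by positivity : (0 : ℝ) ≤ (k : ℝ) ^ numCycles σ))
            (law_nonneg G ht σ)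
          refine h₂.trans_eq ?_
          ring
      _ = Z * ((1 - 1 / (k : ℝ)) * ((((k : ℝ) + 1) * (1 + 1 / q) - d / 2) * N)) +
            permProb G k t A * Z * ((1 - 1 / (k : ℝ)) * (((k : ℝ) + 1) * (d / 2) * N)) := by
          rw [Finset.sum_add_distrib, ← Finset.sum_mul, ← Finset.sum_mul, hpZ]
          rfl
      _ = _ := by ring
  have hdrift := (drift_ge G hk ht).trans (mul_le_mul_of_nonneg_left hW ht)
  rw [← hZ, ← hN] at hdrift
  refine le_of_mul_le_mul_right ?_ (mul_pos hN0 hZ0)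
  linarith

end LargeCycles

/-! ### Sparsity with probability tending to one. -/

section Limit

theorem measurableSingletonClass_simpleGraph (V : Type*) [Countable V] :
    MeasurableSingletonClass (SimpleGraph V) where
  measurableSet_singleton G := by
    have h := SimpleGraph.measurable_edgeSet (measurableSet_singleton (G.edgeSet))
    convert h using 1
    ext H
    simp

theorem coe_regularContaining_empty (d n : ℕ) :
    (↑(regularContaining d (∅ : Finset (Sym2 (Fin n)))) : Set (SimpleGraph (Fin n))) =
      regularGraphs d n := by
  classical
  ext G
  rw [Finset.mem_coe, mem_regularContaining]
  simp only [Finset.coe_empty, Set.empty_subset, and_true, regularGraphs, Set.mem_ofPred_eq,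
    SimpleGraph.IsRegularOfDegree]
  refine forall_congr' fun v => ?_
  rw [Set.ncard_eq_toFinset_card']
  rfl

theorem randomRegular_isSparse_ge {d q n : ℕ} (hd : 0 < d) (hq : 0 < q) (hn : 8 * (d + 1) ≤ n)
    (hnd : Even (n * d)) :
    1 - ENNReal.ofReal (∑ k ∈ Finset.range (n + 1), unionTerm d q (smallDensity d q) n k) ≤
      randomRegular d n {G | IsSparse G (smallDensity d q) q} := by
  classical
  have := measurableSingletonClass_simpleGraph (Fin n)
  -- Without a regular graph `uniformOn` would be the zero measure.
  obtain ⟨G₀, hG₀⟩ := exists_regular_graph (by omega : d < n) hnd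
  set R := regularContaining d (∅ : Finset (Sym2 (Fin n))) with hR
  have hG₀R : G₀ ∈ R := mem_regularContaining.2 ⟨hG₀, by simp⟩
  have hpos : 0 < R.card := Finset.card_pos.2 ⟨G₀, hG₀R⟩
  rw [randomRegular, ← coe_regularContaining_empty, ← hR, tsub_le_iff_right]
  rw [← uniformOn_compl {G | IsSparse G (smallDensity d q) q} R.finite_toSet ⟨G₀, hG₀R⟩]
  refine add_le_add le_rfl ?_
  have hcompl : uniformOn (↑R : Set (SimpleGraph (Fin n)))
      {G | IsSparse G (smallDensity d q) q}ᶜ =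
        uniformOn (↑R : Set (SimpleGraph (Fin n)))
          ↑(R.filter fun G => ¬ IsSparse G (smallDensity d q) q) := by
    rw [← uniformOn_inter_self R.finite_toSet]
    congr 1
    ext G
    simp
  have hcard := card_not_isSparse_le (V := Fin n) (q := q) hd (smallDensity_le hd hq)
    (by rwa [Fintype.card_fin])
  rw [Fintype.card_fin, ← hR] at hcard
  rw [hcompl, uniformOn_apply_finset, Finset.inter_eq_right.2 (Finset.filter_subset _ _)]
  refine ENNReal.div_le_of_le_mul ?_
  rw [← ENNReal.ofReal_natCast, ← ENNReal.ofReal_natCast,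
    ← ENNReal.ofReal_mul (Finset.sum_nonneg fun _ _ => unionTerm_nonneg)]
  exact ENNReal.ofReal_le_ofReal hcard

theorem randomRegular_le_one (d n : ℕ) (E : Set (SimpleGraph (Fin n))) :
    randomRegular d n E ≤ 1 := by
  have : IsZeroOrProbabilityMeasure (randomRegular d n) := by
    unfold randomRegular
    infer_instance
  exact prob_le_one

theorem tendsto_randomRegular_isSparse {d q : ℕ} (hd : 0 < d) (hq : 0 < q) :
    Tendsto (fun n : ℕ => randomRegular d n {G | IsSparse G (smallDensity d q) q})
      (atTop ⊓ 𝓟 {n : ℕ | Even (n * d)}) (𝓝 1) := by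
  have hlow : Tendsto (fun n : ℕ => 1 - ENNReal.ofReal
      (∑ k ∈ Finset.range (n + 1), unionTerm d q (smallDensity d q) n k)) atTop (𝓝 1) := by
    have h := ENNReal.Tendsto.sub (tendsto_const_nhds (x := (1 : ENNReal)) (f := atTop))
      (ENNReal.tendsto_ofReal (tendsto_sum_unionTerm hd hq)) (Or.inl ENNReal.one_ne_top)
    simpa using h
  refine tendsto_of_tendsto_of_tendsto_of_le_of_le' (hlow.mono_left inf_le_left)
    tendsto_const_nhds ?_ (Eventually.of_forall fun n => randomRegular_le_one d n _)
  filter_upwards [(eventually_ge_atTop (8 * (d + 1))).filter_mono inf_le_left,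
    mem_inf_of_right (mem_principal_self _)] with n hn hnd
  exact randomRegular_isSparse_ge hd hq hn hnd

end Limit

end Interchange

end

/-! ### Choice of the constants. -/

theorem theorem1 (θ d : ℕ) (hθ : 2 ≤ θ) (hd : 2 * (1 + θ) < d) (t : ℝ)
    (ht : 2 * (θ : ℝ) * Real.log θ / (((θ : ℝ) - 1) * ((d : ℝ) - 2 * (1 + (θ : ℝ)))) < t) :
    ∃ ε η : ℝ, 0 < ε ∧ 0 < η ∧
      Tendsto
        (fun n : ℕ => Interchange.randomRegular d n
          {G | ε ≤ Interchange.permProb G (θ : ℝ) t (Interchange.hasLargeCycle (Fin n) η)})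
        (atTop ⊓ 𝓟 {n : ℕ | Even (n * d)}) (𝓝 1) := by
  have hθ2 : (2 : ℝ) ≤ θ := by exact_mod_cast hθ
  have hd' : 2 * (1 + (θ : ℝ)) < d := by exact_mod_cast hd
  have hd0 : 0 < d := by omega
  have hlog : 0 < Real.log θ := Real.log_pos (by linarith)
  have hden : 0 < ((θ : ℝ) - 1) * ((d : ℝ) - 2 * (1 + (θ : ℝ))) :=
    mul_pos (by linarith) (by linarith)
  have ht0 : 0 < t := lt_of_le_of_lt (by positivity) ht
  -- The surplus in the drift inequality with `1 / q` and the long cycles removed; `g > 0` is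
  -- exactly `t > T(θ, d)`.
  set g := t * ((1 - 1 / (θ : ℝ)) * (d / 2 - (θ + 1))) - Real.log θ with hg
  have hg0 : 0 < g := by
    rw [div_lt_iff₀ hden] at ht
    have h : t * ((1 - 1 / (θ : ℝ)) * (d / 2 - (θ + 1))) =
        t * (((θ : ℝ) - 1) * ((d : ℝ) - 2 * (1 + (θ : ℝ)))) / (2 * θ) := by
      field_simp
      ring
    rw [hg, h, sub_pos, lt_div_iff₀ (by positivity)]
    linarith
  set c := t * (1 - 1 / (θ : ℝ)) * (θ + 1) with hc
  have hθ1 : 0 < 1 - 1 / (θ : ℝ) := by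
    rw [sub_pos, div_lt_one (by positivity)]
    linarith
  have hc0 : 0 < c := by positivity
  -- The error `c / q` uses less than half of `g`; the remaining `g / 2` must be covered by `c * d /
  -- 2 * p`, whence `ε = g / (c * d)`.
  obtain ⟨q, hq⟩ := exists_nat_gt (2 * c / g)
  have hq0 : (0 : ℝ) < q := lt_trans (by positivity) hq
  have hcq : c * (1 / q) < g / 2 := by
    rw [div_lt_iff₀ hg0] at hq
    rw [mul_one_div, div_lt_iff₀ hq0]
    linarith
  have hq' : 0 < q := by exact_mod_cast hq0
  have hdR : (0 : ℝ) < d := by exact_mod_cast hd0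
  refine ⟨g / (c * d), Interchange.smallDensity d q, by positivity,
    Interchange.smallDensity_pos hd0 q, ?_⟩
  refine tendsto_of_tendsto_of_tendsto_of_le_of_le'
    (Interchange.tendsto_randomRegular_isSparse hd0 hq') tendsto_const_nhds ?_
    (Eventually.of_forall fun n => Interchange.randomRegular_le_one d n _)
  filter_upwards [(eventually_ge_atTop 1).filter_mono inf_le_left] with n hn
  have := Interchange.measurableSingletonClass_simpleGraph (Fin n)
  have hfin : (Interchange.regularGraphs d n).Finite := Set.toFinite _
  -- Intersecting with the support makes regularity available for each sparse graph.
  rw [Interchange.randomRegular, ← uniformOn_inter_self hfin]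
  refine measure_mono fun G hG => ?_
  obtain ⟨hreg, hsparse⟩ := hG
  rw [← Interchange.coe_regularContaining_empty, Finset.mem_coe,
    Interchange.mem_regularContaining] at hreg
  have : Nonempty (Fin n) := Fin.pos_iff_nonempty.1 hn
  have h := Interchange.permProb_hasLargeCycle_ge hsparse hreg.1 (by omega : 1 ≤ θ) ht0.le
  rw [Set.mem_ofPred_eq, div_le_iff₀ (by positivity)]
  set p := Interchange.permProb G θ t (Interchange.hasLargeCycle (Fin n) _)
  have h' : t * ((1 - 1 / (θ : ℝ)) * (((θ : ℝ) + 1) * (1 + 1 / q) - d / 2 +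
      ((θ : ℝ) + 1) * (d / 2) * p)) =
        c * (1 / q) + c * d / 2 * p - (g + Real.log θ) := by
    rw [hc, hg]
    ring
  rw [h'] at h
  linarith
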